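/- Let $V$ be a real inner product space of dimension $n\ge 1$, and let $G$ be an essential reflection group on $V$, that is, a finite group of orthogonal transformations of $V$ that is generated by reflections and fixes no nonzero vector. Let $\pi_1,\dots,\pi_n$ be a set of basic invariants of $G$, that is, homogeneous, algebraically independent polynomials that generate the algebra $\mathbb{R}[V]^G$ of $G$-invariant polynomials on $V$. For $0\le i\le n$, let $\mathcal{H}_i(G)$ be the set of the points of $V$ that are contained in an $i$-dimensional intersection of reflection hyperplanes of $G$, where a reflection hyperplane is the fixed space of a reflection in $G$ (and the empty intersection is $V$); in particular, $\mathcal{H}_{n-1}(G)$ is the union of the reflection hyperplanes. Let $J\subset\{1,\dots,n\}$ with $|J|=n-1$, let $f,f_1,\dots,f_m\in\mathbb{R}[\pi_i : i\in J]$, and let $$S=\{p\in V : f_1(p)\ge 0,\dots,f_m(p)\ge 0\}.$$ Then the following hold. (i) $S$ is nonempty if and only if $S\cap\mathcal{H}_{n-1}(G)\ne\emptyset$. (ii) $f(q)\ge 0$ for all $q\in S$ if and only if $f(q)\ge 0$ for all $q\in S\cap\mathcal{H}_{n-1}(G)$. -/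

import Mathlib

namespace ReflGroup

/-- The value at the point `p` of a polynomial `f` in the linear coordinates on `V` that the
basis `b` determines. As `ℝ` is infinite, a polynomial is determined by its values. -/
noncomputable def value {V : Type*} [AddCommGroup V] [Module ℝ V] {n : ℕ}
    (b : Module.Basis (Fin n) ℝ V) (f : MvPolynomial (Fin n) ℝ) (p : V) : ℝ :=
  MvPolynomial.eval (fun i => b.repr p i) f

section Group

variable {V : Type*} [NormedAddCommGroup V] [InnerProductSpace ℝ V]

/-- `g` is the orthogonal reflection in the hyperplane orthogonal to some nonzero vector. -/
def IsReflection (g : V ≃ₗᵢ[ℝ] V) : Prop :=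
  ∃ v : V, v ≠ 0 ∧ g = (Submodule.span ℝ {v})ᗮ.reflection

/-- A finite group of orthogonal transformations that is generated by its reflections. -/
structure IsReflectionGroup (G : Subgroup (V ≃ₗᵢ[ℝ] V)) : Prop where
  finite : Finite G
  generated : Subgroup.closure {g : V ≃ₗᵢ[ℝ] V | g ∈ G ∧ IsReflection g} = G

/-- `G` fixes no nontrivial linear subspace (pointwise). -/
def IsEssential (G : Subgroup (V ≃ₗᵢ[ℝ] V)) : Prop :=
  ∀ U : Submodule ℝ V, (∀ g ∈ G, ∀ p ∈ U, g p = p) → U = ⊥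

/-- The reflection arrangement: the fixed hyperplanes of the reflections in `G`. -/
def arrangement (G : Subgroup (V ≃ₗᵢ[ℝ] V)) : Set (Submodule ℝ V) :=
  {H | ∃ g ∈ G, IsReflection g ∧ ∀ p : V, p ∈ H ↔ g p = p}

/-- The flats: intersections of reflection hyperplanes. The empty intersection is `V`. -/
def flats (G : Subgroup (V ≃ₗᵢ[ℝ] V)) : Set (Submodule ℝ V) :=
  {F | ∃ A : Set (Submodule ℝ V), A ⊆ arrangement G ∧ F = sInf A}

/-- The stratum `ℋ_i(G)`: the points that lie in a flat of dimension `i`. -/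
def stratum (G : Subgroup (V ≃ₗᵢ[ℝ] V)) (i : ℕ) : Set V :=
  {p | ∃ F ∈ flats G, Module.finrank ℝ F = i ∧ p ∈ F}

/-- The algebra `ℝ[V]^G` of the polynomials `f` with `f (g⁻¹ p) = f p` for all `g ∈ G`, `p ∈ V`. -/
noncomputable def invariants {n : ℕ} (b : Module.Basis (Fin n) ℝ V)
    (G : Subgroup (V ≃ₗᵢ[ℝ] V)) : Subalgebra ℝ (MvPolynomial (Fin n) ℝ) where
  carrier := {f | ∀ g ∈ G, ∀ p : V, value b f (g⁻¹ p) = value b f p}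
  mul_mem' := by
    intro f h hf hh g hg p
    have h1 := hf g hg p
    have h2 := hh g hg p
    simp only [value, map_mul] at h1 h2 ⊢
    rw [h1, h2]
  add_mem' := by
    intro f h hf hh g hg p
    have h1 := hf g hg p
    have h2 := hh g hg p
    simp only [value, map_add] at h1 h2 ⊢
    rw [h1, h2]
  algebraMap_mem' := by
    intro r g _ p
    simp [value, MvPolynomial.algebraMap_eq]

/-- `π₁, …, πₙ` (with `n = dim V`) is a set of basic invariants of `G`: homogeneous,
algebraically independent generators of the algebra of invariant polynomials. -/
structure IsBasicInvariants {n : ℕ} (b : Module.Basis (Fin n) ℝ V)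
    (G : Subgroup (V ≃ₗᵢ[ℝ] V)) (π : Fin n → MvPolynomial (Fin n) ℝ) : Prop where
  homogeneous : ∀ i, ∃ d : ℕ, (π i).IsHomogeneous d
  algebraicIndependent : AlgebraicIndependent ℝ π
  generate : Algebra.adjoin ℝ (Set.range π) = invariants b G

end Group

/-- The set of the points at which `f₁, …, f_m` are all nonnegative. -/
def semialgebraicSet {V : Type*} [AddCommGroup V] [Module ℝ V] {n m : ℕ}
    (b : Module.Basis (Fin n) ℝ V) (fs : Fin m → MvPolynomial (Fin n) ℝ) : Set V :=
  {p | ∀ i, 0 ≤ value b (fs i) p}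

end ReflGroup

/-! Let k be the index missing from J. The polynomials f, f_1, ..., f_m are constant on the joint
fibers of the π_i with i ≠ k, so it suffices that each such fiber meets a reflection hyperplane
(`exists_mem_stratum_value_eq`).

Off the hyperplanes the stabilizer in G is trivial (`IsRegular.eq_one_of_apply_eq`). Hence the
differentials of the invariants separate vectors there, the image of (π_1, ..., π_n) contains a
neighbourhood of the image point (`range_value_mem_nhds`), and π_k can be raised or lowered within
the fiber (`exists_value_update`). An extremum of π_k on the fiber therefore lies on a hyperplane.

Such an extremum exists because ‖p‖² = ∑ c_i π_i(p) (`exists_norm_sq_eq_sum`): on the fiber ‖p‖² is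
c_k π_k plus a constant. If c_k ≠ 0, the point nearest the origin is an extremum of π_k; if c_k = 0,
the fiber lies on a sphere and is compact. -/

open scoped RealInnerProductSpace Topology

namespace ReflGroup

/-! ### Positive and simple roots; stabilizers of regular points -/

section Roots

variable {V : Type*} [NormedAddCommGroup V] [InnerProductSpace ℝ V]

/-- The orthogonal reflection in the hyperplane orthogonal to `α`. -/
noncomputable def refl (α : V) : V ≃ₗᵢ[ℝ] V := (Submodule.span ℝ {α})ᗮ.reflection

theorem refl_apply {α : V} (hα : ‖α‖ = 1) (x : V) : refl α x = x - (2 * ⟪α, x⟫) • α := by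
  rw [refl, Submodule.reflection_orthogonal_apply, Submodule.reflection_singleton_apply, hα]
  simp only [RCLike.ofReal_real_eq_id, id_eq, one_pow, div_one, neg_sub, two_smul, two_mul, add_smul]

theorem refl_neg (α : V) : refl (-α) = refl α := by
  have h : Submodule.span ℝ {-α} = Submodule.span ℝ {α} := by
    rw [← Set.neg_singleton, Submodule.span_neg]
  simp only [refl, h]

theorem refl_self (α : V) : refl α α = -α :=
  Submodule.reflection_orthogonalComplement_singleton_eq_neg α

theorem refl_mul_self (α : V) : refl α * refl α = 1 :=
  Submodule.reflection_mul_reflection _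

theorem isReflection_refl {α : V} (hα : ‖α‖ = 1) : IsReflection (refl α) :=
  ⟨α, fun h => by simp [h] at hα, rfl⟩

theorem refl_conj {α : V} (hα : ‖α‖ = 1) (g : V ≃ₗᵢ[ℝ] V) :
    refl (g α) = g * refl α * g⁻¹ := by
  have hg : ‖g α‖ = 1 := by rw [g.norm_map, hα]
  ext x
  have hx : g (g⁻¹ x) = x := g.apply_symm_apply x
  simp only [LinearIsometryEquiv.coe_mul, Function.comp_apply]
  rw [refl_apply hg, refl_apply hα, map_sub, map_smul, hx, ← g.inner_map_map α, hx]

theorem IsReflection.exists_unit {g : V ≃ₗᵢ[ℝ] V} (hg : IsReflection g) :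
    ∃ α : V, ‖α‖ = 1 ∧ g = refl α := by
  obtain ⟨v, hv, rfl⟩ := hg
  have hn : ‖v‖⁻¹ ≠ 0 := inv_ne_zero (norm_ne_zero_iff.mpr hv)
  refine ⟨‖v‖⁻¹ • v, norm_smul_inv_norm (𝕜 := ℝ) hv, ?_⟩
  simp only [refl, Submodule.span_singleton_smul_eq hn.isUnit]

/-- The unit roots of `G` that are positive at `q`. -/
def IsPosRoot (G : Subgroup (V ≃ₗᵢ[ℝ] V)) (q α : V) : Prop :=
  ‖α‖ = 1 ∧ refl α ∈ G ∧ 0 < ⟪α, q⟫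

/-- A positive root whose reflection makes no other positive root negative. -/
def IsSimpleRoot (G : Subgroup (V ≃ₗᵢ[ℝ] V)) (q α : V) : Prop :=
  IsPosRoot G q α ∧ ∀ β, IsPosRoot G q β → β ≠ α → IsPosRoot G q (refl α β)

/-- `q` lies on no reflection hyperplane of `G`. -/
def IsRegular (G : Subgroup (V ≃ₗᵢ[ℝ] V)) (q : V) : Prop :=
  ∀ g ∈ G, IsReflection g → g q ≠ q

variable {G : Subgroup (V ≃ₗᵢ[ℝ] V)} {q : V}

theorem isPosRoot_or_neg (hq : IsRegular G q) {α : V} (hα : ‖α‖ = 1) (hG : refl α ∈ G) :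
    IsPosRoot G q α ∨ IsPosRoot G q (-α) := by
  have h0 : ⟪α, q⟫ ≠ 0 := fun h =>
    hq _ hG (isReflection_refl hα) (by rw [refl_apply hα, h]; simp)
  rcases lt_or_gt_of_ne h0 with h | h
  · exact Or.inr ⟨by rwa [norm_neg], by rwa [refl_neg], by rw [inner_neg_left]; linarith⟩
  · exact Or.inl ⟨hα, hG, h⟩

theorem IsPosRoot.not_neg {α : V} (h : IsPosRoot G q α) : ¬ IsPosRoot G q (-α) := fun h' => by
  have h1 := h.2.2
  have h2 := h'.2.2
  rw [inner_neg_left] at h2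
  linarith

theorem refl_apply_mem {α : V} (hα : ‖α‖ = 1) (hG : refl α ∈ G) {g : V ≃ₗᵢ[ℝ] V} (hg : g ∈ G) :
    ‖g α‖ = 1 ∧ refl (g α) ∈ G := by
  refine ⟨by rw [g.norm_map, hα], ?_⟩
  rw [refl_conj hα]
  exact G.mul_mem (G.mul_mem hg hG) (G.inv_mem hg)

/-- The mirror determines its unit normal up to sign, and positivity at `q` picks the sign. This
injectivity makes the positive roots of a finite group finite in number. -/
theorem IsPosRoot.eq_of_refl_eq {α β : V} (hα : IsPosRoot G q α) (hβ : IsPosRoot G q β)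
    (h : refl α = refl β) : α = β := by
  have h1 : refl β α = -α := by rw [← h, refl_self]
  rw [refl_apply hβ.1] at h1
  have h2 : α = ⟪β, α⟫ • β := by
    have : (2 : ℝ) • α = (2 : ℝ) • (⟪β, α⟫ • β) := by
      rw [smul_smul, two_smul, sub_eq_iff_eq_add] at *
      nth_rewrite 1 [h1]
      abel
    exact smul_right_injective V (two_ne_zero' ℝ) this
  have h3 : |⟪β, α⟫| = 1 := by
    have := congrArg norm h2
    rwa [norm_smul, hα.1, hβ.1, mul_one, Real.norm_eq_abs, eq_comm] at this
  have h4 : 0 < ⟪β, α⟫ := by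
    have := hα.2.2
    rw [h2, real_inner_smul_left] at this
    exact pos_of_mul_pos_left this hβ.2.2.le
  rw [abs_of_pos h4] at h3
  rw [h2, h3, one_smul]

theorem finite_setOf_isPosRoot [Finite G] (q : V) : {α | IsPosRoot G q α}.Finite := by
  refine Set.Finite.of_finite_image (f := refl) ((Set.toFinite (G : Set (V ≃ₗᵢ[ℝ] V))).subset ?_) ?_
  · rintro _ ⟨α, hα, rfl⟩
    exact hα.2.1
  · intro α hα β hβ h
    exact hα.eq_of_refl_eq hβ h

/-- Each positive root has a positive inner product with some simple root. -/
theorem IsPosRoot.exists_simple [Finite G] (hq : IsRegular G q) {α : V} (hα : IsPosRoot G q α) :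
    ∃ γ, IsSimpleRoot G q γ ∧ 0 < ⟪γ, α⟫ := by
  set A : Set V := {β | IsPosRoot G q β ∧ 0 < ⟪β, α⟫}
  have hAfin : A.Finite := (finite_setOf_isPosRoot q).subset fun β hβ => hβ.1
  have hA : α ∈ A := ⟨hα, by rw [real_inner_self_eq_norm_sq, hα.1]; norm_num⟩
  -- Moving from `q` along `-α`, the minimal ratio `r` is the first time a positive root vanishes.
  -- So all positive roots are nonnegative at `q - r • α`, which is `hle`.
  obtain ⟨γ₀, hγ₀, hmin₀⟩ := hAfin.exists_minimalFor (fun β => ⟪β, q⟫ / ⟪β, α⟫) A ⟨α, hA⟩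
  set r := ⟪γ₀, q⟫ / ⟪γ₀, α⟫
  have hr : 0 < r := div_pos hγ₀.1.2.2 hγ₀.2
  have hle : ∀ β, IsPosRoot G q β → r * ⟪β, α⟫ ≤ ⟪β, q⟫ := by
    intro β hβ
    rcases le_or_gt ⟪β, α⟫ 0 with h | h
    · exact (mul_nonpos_of_nonneg_of_nonpos hr.le h).trans hβ.2.2.le
    · rw [← le_div_iff₀ h]
      rcases le_total r (⟪β, q⟫ / ⟪β, α⟫) with h' | h'
      · exact h'
      · exact hmin₀ (j := β) ⟨hβ, h⟩ h'
  -- The positive roots that vanish at `q - r • α`. There may be several; one that is smallest at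
  -- `q` turns out to be simple.
  set B : Set V := {β | IsPosRoot G q β ∧ ⟪β, q⟫ = r * ⟪β, α⟫}
  have hBfin : B.Finite := (finite_setOf_isPosRoot q).subset fun β hβ => hβ.1
  obtain ⟨γ, hγ, hmin⟩ := hBfin.exists_minimalFor (fun β => ⟪β, q⟫) B
    ⟨γ₀, hγ₀.1, (div_mul_cancel₀ _ hγ₀.2.ne').symm⟩
  have hmin' : ∀ β ∈ B, ⟪γ, q⟫ ≤ ⟪β, q⟫ := fun β hβ =>
    (le_total _ _).elim id fun h => hmin hβ h
  have hγα : 0 < ⟪γ, α⟫ := by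
    have := hγ.1.2.2
    rw [hγ.2] at this
    exact pos_of_mul_pos_right this hr.le
  refine ⟨γ, ⟨hγ.1, fun δ hδ hne => ?_⟩, hγα⟩
  have hm := refl_apply_mem hδ.1 hδ.2.1 hγ.1.2.1
  refine (isPosRoot_or_neg hq hm.1 hm.2).resolve_right fun hε => ?_
  -- `δ` and `-refl γ δ` are nonnegative at `q - r • α`, and their sum, a multiple of `γ`, vanishes
  -- there; so both lie in `B`. Minimality of `γ` then forces `1 ≤ ⟪γ, δ⟫`, impossible for distinct
  -- unit vectors.
  have hεeq : -refl γ δ = (2 * ⟪γ, δ⟫) • γ - δ := by rw [refl_apply hγ.1.1]; abel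
  rw [hεeq] at hε
  have h1 := hle δ hδ
  have h2 := hle _ hε
  have h3 := hγ.2
  have h4 := hε.2.2
  have hlt : ⟪γ, δ⟫ < 1 := (inner_lt_one_iff_real_of_norm_eq_one hγ.1.1 hδ.1).mpr hne.symm
  simp only [inner_sub_left, real_inner_smul_left] at h2 h4
  have h5 := hδ.2.2
  have h6 := hγ.1.2.2
  have e1 : ⟪δ, q⟫ = r * ⟪δ, α⟫ := by
    rw [h3] at h2
    nlinarith
  have h7 := hmin' δ ⟨hδ, e1⟩
  have h8 := hmin' _ ⟨hε, by simp only [inner_sub_left, real_inner_smul_left]; rw [h3, e1]; ring⟩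
  simp only [inner_sub_left, real_inner_smul_left] at h8
  nlinarith

/-- The product of the reflections in the members of a list of roots. -/
noncomputable def reflProd (l : List V) : V ≃ₗᵢ[ℝ] V := (l.map refl).prod

@[simp] theorem reflProd_nil : reflProd ([] : List V) = 1 := rfl

@[simp] theorem reflProd_cons (α : V) (l : List V) : reflProd (α :: l) = refl α * reflProd l := by
  simp [reflProd]

theorem reflProd_append (l l' : List V) : reflProd (l ++ l') = reflProd l * reflProd l' := by
  simp [reflProd]

/-- Each reflection in a positive root is a product of simple reflections. -/
theorem IsPosRoot.exists_reflProd [Finite G] (hq : IsRegular G q) {α : V}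
    (hα : IsPosRoot G q α) :
    ∃ l : List V, (∀ γ ∈ l, IsSimpleRoot G q γ) ∧ refl α = reflProd l := by
  by_contra hcon
  set A : Set V := {β | IsPosRoot G q β ∧
    ¬ ∃ l : List V, (∀ γ ∈ l, IsSimpleRoot G q γ) ∧ refl β = reflProd l}
  have hA : A.Finite := (finite_setOf_isPosRoot q).subset fun β hβ => hβ.1
  -- For a counterexample `β` smallest at `q`, `refl γ β` is positive and smaller; conjugating its
  -- word by `refl γ` gives one for `refl β`.
  obtain ⟨β, ⟨hβ, hβn⟩, hmin⟩ := hA.exists_minimalFor (fun β => ⟪β, q⟫) A ⟨α, hα, hcon⟩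
  obtain ⟨γ, hγ, hpos⟩ := hβ.exists_simple hq
  rcases eq_or_ne β γ with rfl | hne
  · exact hβn ⟨[β], by simpa using hγ, by simp⟩
  have hp := hγ.2 β hβ hne
  have hlt : ⟪refl γ β, q⟫ < ⟪β, q⟫ := by
    rw [refl_apply hγ.1.1, inner_sub_left, real_inner_smul_left]
    have := mul_pos hpos hγ.1.2.2
    linarith
  by_cases h : ∃ l : List V, (∀ γ ∈ l, IsSimpleRoot G q γ) ∧ refl (refl γ β) = reflProd l
  · obtain ⟨l, hl, he⟩ := h
    refine hβn ⟨γ :: (l ++ [γ]), ?_, ?_⟩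
    · intro δ hδ
      simp only [List.mem_cons, List.mem_append, List.not_mem_nil, or_false] at hδ
      rcases hδ with rfl | hδ | rfl
      exacts [hγ, hl _ hδ, hγ]
    · have hinv : (refl γ)⁻¹ = refl γ := inv_eq_of_mul_eq_one_left (refl_mul_self γ)
      rw [reflProd_cons, reflProd_append, ← he, refl_conj hβ.1, hinv, reflProd_cons, reflProd_nil,
        mul_one, mul_assoc, mul_assoc, refl_mul_self, mul_one, ← mul_assoc,
        refl_mul_self, one_mul]
  · exact (hmin (j := refl γ β) ⟨hp, h⟩ hlt.le).not_gt hlt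

/-- The exchange condition. -/
theorem exists_reflProd_exchange (hq : IsRegular G q) {α : V} (hα : IsSimpleRoot G q α) :
    ∀ l : List V, (∀ γ ∈ l, IsSimpleRoot G q γ) → ¬ IsPosRoot G q (reflProd l α) →
      ∃ l' : List V, (∀ γ ∈ l', IsSimpleRoot G q γ) ∧ l'.length < l.length ∧
        reflProd l * refl α = reflProd l'
  | [], _, h => absurd (by simpa using hα.1) h
  | γ :: l, hl, h => by
    have hγ := hl γ List.mem_cons_self
    have hl' : ∀ δ ∈ l, IsSimpleRoot G q δ := fun δ hδ => hl δ (List.mem_cons_of_mem _ hδ)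
    by_cases hp : IsPosRoot G q (reflProd l α)
    -- `γ` is the letter at which the root stops being positive. A simple reflection does this to no
    -- positive root but its own, so the root reaching it is `γ`, and conjugation cancels the
    -- letter.
    · have he : reflProd l α = γ := by
        by_contra hne
        exact h (by simpa using hγ.2 _ hp hne)
      refine ⟨l, hl', by simp, ?_⟩
      have h1 := refl_conj hα.1.1 (reflProd l)
      rw [he] at h1
      rw [reflProd_cons, h1]
      simp only [mul_assoc, inv_mul_cancel_left, refl_mul_self, mul_one]
    · obtain ⟨l', h1, h2, h3⟩ := exists_reflProd_exchange hq hα l hl' hp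
      refine ⟨γ :: l', ?_, by simpa using h2, by rw [reflProd_cons, reflProd_cons, mul_assoc, h3]⟩
      intro δ hδ
      rcases List.mem_cons.mp hδ with rfl | hδ
      exacts [hγ, h1 _ hδ]

/-- A point on no reflection hyperplane of a finite reflection group has a trivial stabilizer. -/
theorem IsRegular.eq_one_of_apply_eq (hG : IsReflectionGroup G) (hq : IsRegular G q)
    {g : V ≃ₗᵢ[ℝ] V} (hg : g ∈ G) (hgq : g q = q) : g = 1 := by
  have := hG.finite
  have hex : ∃ l : List V, (∀ γ ∈ l, IsSimpleRoot G q γ) ∧ g = reflProd l := by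
    have hinv : ∀ s : V ≃ₗᵢ[ℝ] V, IsReflection s → s⁻¹ = s := by
      intro s hs
      obtain ⟨α, -, rfl⟩ := hs.exists_unit
      exact inv_eq_of_mul_eq_one_left (refl_mul_self α)
    have hrefl : ∀ s ∈ G, IsReflection s →
        ∃ l : List V, (∀ γ ∈ l, IsSimpleRoot G q γ) ∧ s = reflProd l := by
      intro s hs hr
      obtain ⟨α, hα, rfl⟩ := hr.exists_unit
      rcases isPosRoot_or_neg hq hα hs with h | h
      · exact h.exists_reflProd hq
      · rw [← refl_neg]
        exact h.exists_reflProd hq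
    rw [← hG.generated] at hg
    refine Subgroup.closure_induction_left ⟨[], by simp, rfl⟩ ?_ ?_ hg
    · rintro s ⟨hs, hr⟩ y - ⟨l, hl, rfl⟩
      obtain ⟨l', hl', rfl⟩ := hrefl s hs hr
      refine ⟨l' ++ l, ?_, (reflProd_append _ _).symm⟩
      intro γ hγ
      exact (List.mem_append.mp hγ).elim (hl' γ) (hl γ)
    · rintro s ⟨hs, hr⟩ y - ⟨l, hl, rfl⟩
      rw [hinv s hr]
      obtain ⟨l', hl', rfl⟩ := hrefl s hs hr
      refine ⟨l' ++ l, ?_, (reflProd_append _ _).symm⟩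
      intro γ hγ
      exact (List.mem_append.mp hγ).elim (hl' γ) (hl γ)
  -- Since `g` fixes `q`, it preserves positive roots. If a shortest word for `g` ended in `α`, the
  -- word before it would send `α` to a non-positive root, and exchange would shorten the word.
  have hpos : ∀ α, IsPosRoot G q α → IsPosRoot G q (g α) := by
    intro α hα
    have hm := refl_apply_mem hα.1 hα.2.1 hg
    refine ⟨hm.1, hm.2, ?_⟩
    rw [← hgq, g.inner_map_map]
    exact hα.2.2
  classical
  have hP : ∃ k, ∃ l : List V, (∀ γ ∈ l, IsSimpleRoot G q γ) ∧ g = reflProd l ∧ l.length = k :=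
    let ⟨l, hl, h⟩ := hex
    ⟨_, l, hl, h, rfl⟩
  obtain ⟨l, hl, hgl, hlen⟩ := Nat.find_spec hP
  rcases List.eq_nil_or_concat l with rfl | ⟨l₁, α, rfl⟩
  · simpa using hgl
  exfalso
  have hα := hl α (by simp)
  have hl₁ : ∀ γ ∈ l₁, IsSimpleRoot G q γ := fun γ hγ => hl γ (by simp [hγ])
  rw [List.concat_eq_append, reflProd_append, reflProd_cons, reflProd_nil, mul_one] at hgl
  have hn : ¬ IsPosRoot G q (reflProd l₁ α) := by
    intro h
    have h1 := hpos α hα.1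
    rw [hgl, LinearIsometryEquiv.coe_mul, Function.comp_apply, refl_self, map_neg] at h1
    exact h.not_neg h1
  obtain ⟨l', h1, h2, h3⟩ := exists_reflProd_exchange hq hα l₁ hl₁ hn
  refine Nat.find_min hP (m := l'.length) ?_ ⟨l', h1, hgl.trans h3, rfl⟩
  rw [← hlen, List.concat_eq_append, List.length_append]
  omega

end Roots

/-! ### Polynomial functions and differentials of invariants -/

section Value

variable {V : Type*} [NormedAddCommGroup V] [InnerProductSpace ℝ V] {n : ℕ}
  (b : Module.Basis (Fin n) ℝ V)

@[simp] theorem value_add (f g : MvPolynomial (Fin n) ℝ) (p : V) :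
    value b (f + g) p = value b f p + value b g p := by simp [value]

@[simp] theorem value_mul (f g : MvPolynomial (Fin n) ℝ) (p : V) :
    value b (f * g) p = value b f p * value b g p := by simp [value]

@[simp] theorem value_C (c : ℝ) (p : V) : value b (MvPolynomial.C c) p = c := by simp [value]

@[simp] theorem value_algebraMap (c : ℝ) (p : V) :
    value b (algebraMap ℝ (MvPolynomial (Fin n) ℝ) c) p = c := by simp [value]

theorem value_smul (c : ℝ) (f : MvPolynomial (Fin n) ℝ) (p : V) :
    value b (c • f) p = c * value b f p := by simp [value, MvPolynomial.smul_eval]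

theorem value_sum {ι : Type*} (s : Finset ι) (f : ι → MvPolynomial (Fin n) ℝ) (p : V) :
    value b (∑ i ∈ s, f i) p = ∑ i ∈ s, value b (f i) p := by simp [value]

theorem value_prod {ι : Type*} (s : Finset ι) (f : ι → MvPolynomial (Fin n) ℝ) (p : V) :
    value b (∏ i ∈ s, f i) p = ∏ i ∈ s, value b (f i) p := by simp [value]

/-- The linear form `⟪w, ·⟫` as a polynomial in the coordinates. -/
noncomputable def innerPoly (w : V) : MvPolynomial (Fin n) ℝ :=
  ∑ i, MvPolynomial.C ⟪w, b i⟫ * MvPolynomial.X i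

theorem value_innerPoly (w p : V) : value b (innerPoly b w) p = ⟪w, p⟫ := by
  conv_rhs => rw [← b.sum_repr p, inner_sum]
  simp only [innerPoly, value, map_sum, map_mul, MvPolynomial.eval_C, MvPolynomial.eval_X,
    real_inner_smul_right, mul_comm]

theorem value_eq_of_mem_adjoin {s : Set (MvPolynomial (Fin n) ℝ)} {p q : V}
    (h : ∀ f ∈ s, value b f p = value b f q) {f : MvPolynomial (Fin n) ℝ}
    (hf : f ∈ Algebra.adjoin ℝ s) : value b f p = value b f q := by
  induction hf using Algebra.adjoin_induction with
  | mem f hf => exact h f hf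
  | algebraMap r => simp
  | add f g _ _ hf hg => simp [hf, hg]
  | mul f g _ _ hf hg => simp [hf, hg]

theorem contDiff_value (f : MvPolynomial (Fin n) ℝ) : ContDiff ℝ 1 (value b f) := by
  have := Module.Finite.of_basis b
  have hX : ∀ i, ContDiff ℝ 1 fun p => b.repr p i := fun i =>
    ((b.coord i).toContinuousLinearMap).contDiff
  induction f using MvPolynomial.induction_on with
  | C a => simpa only [funext (value_C b a)] using contDiff_const
  | add f g hf hg => simpa only [funext (value_add b f g)] using hf.add hg
  | mul_X f i hf =>
    have : value b (f * MvPolynomial.X i) = fun p => value b f p * b.repr p i := by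
      funext p
      simp [value]
    rw [this]
    exact hf.mul (hX i)

theorem continuous_value (f : MvPolynomial (Fin n) ℝ) : Continuous (value b f) :=
  (contDiff_value b f).continuous

theorem differentiable_value (f : MvPolynomial (Fin n) ℝ) : Differentiable ℝ (value b f) :=
  (contDiff_value b f).differentiable one_ne_zero

/-- A vector annihilated by the differentials at `q` of the generators is annihilated by the
differentials of the whole algebra. -/
theorem fderiv_value_eq_zero_of_mem_adjoin {s : Set (MvPolynomial (Fin n) ℝ)} {q v : V}
    (h : ∀ f ∈ s, fderiv ℝ (value b f) q v = 0) {f : MvPolynomial (Fin n) ℝ}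
    (hf : f ∈ Algebra.adjoin ℝ s) : fderiv ℝ (value b f) q v = 0 := by
  have hd := fun f => (differentiable_value b f).differentiableAt (x := q)
  induction hf using Algebra.adjoin_induction with
  | mem f hf => exact h f hf
  | algebraMap r => rw [funext (value_algebraMap b r)]; simp
  | add f g _ _ hf hg =>
    rw [funext (value_add b f g), fderiv_fun_add (hd f) (hd g)]
    simp [hf, hg]
  | mul f g _ _ hf hg =>
    rw [funext (value_mul b f g), fderiv_fun_mul (hd f) (hd g)]
    simp [hf, hg]

/-- At a point with trivial stabilizer, each nonzero vector is detected by the differential of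
some invariant. -/
theorem exists_invariant_fderiv_ne_zero {G : Subgroup (V ≃ₗᵢ[ℝ] V)} [Finite G] {q v : V}
    (hq : ∀ g ∈ G, g q = q → g = 1) (hv : v ≠ 0) :
    ∃ F ∈ invariants b G, fderiv ℝ (value b F) q v ≠ 0 := by
  classical
  have := Fintype.ofFinite G
  -- `h` has gradient `M q • v` at `q`, with `M q ≠ 0`, and vanishes to second order at the other
  -- points of the orbit. In `F`, the sum of the translates of `h`, only the identity contributes to
  -- the differential at `q`.
  let u : G → V := fun k => q - (k : V ≃ₗᵢ[ℝ] V) q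
  let M : V → ℝ := fun x => ∏ k ∈ Finset.univ.erase (1 : G), ⟪u k, x - (k : V ≃ₗᵢ[ℝ] V) q⟫ ^ 2
  let h : V → ℝ := fun x => ⟪v, x - q⟫ * M x
  let F : MvPolynomial (Fin n) ℝ := ∑ g : G,
    (innerPoly b ((g : V ≃ₗᵢ[ℝ] V) v) + MvPolynomial.C (-⟪v, q⟫)) *
      ∏ k ∈ Finset.univ.erase (1 : G),
        (innerPoly b ((g : V ≃ₗᵢ[ℝ] V) (u k)) + MvPolynomial.C (-⟪u k, (k : V ≃ₗᵢ[ℝ] V) q⟫)) ^ 2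
  have hadj : ∀ (g : V ≃ₗᵢ[ℝ] V) (w x : V), ⟪g w, x⟫ = ⟪w, g⁻¹ x⟫ := by
    intro g w x
    have hx : g (g⁻¹ x) = x := g.apply_symm_apply x
    conv_lhs => rw [← hx, g.inner_map_map]
  have hF : ∀ x, value b F x = ∑ g : G, h ((g : V ≃ₗᵢ[ℝ] V)⁻¹ x) := by
    intro x
    simp only [F, value_sum, value_mul, value_prod, value_add, value_innerPoly, value_C, pow_two,
      h, M, hadj, inner_sub_right, ← sub_eq_add_neg]
  refine ⟨F, fun g hg p => ?_, ?_⟩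
  · rw [hF, hF]
    refine Fintype.sum_equiv (Equiv.mulLeft (⟨g, hg⟩ : G)) _ _ fun k => ?_
    simp only [Equiv.coe_mulLeft, Subgroup.coe_mul, mul_inv_rev, LinearIsometryEquiv.coe_mul,
      Function.comp_apply]
  · have hdiff : ∀ w y x : V, HasFDerivAt (fun x => ⟪w, x - y⟫) (innerSL ℝ w) x := fun w y x =>
      (innerSL ℝ w).hasFDerivAt.comp x ((hasFDerivAt_id x).sub_const y)
    have hprod : ∀ (s : Finset G) (x : V), DifferentiableAt ℝ
        (fun x => ∏ k ∈ s, ⟪u k, x - (k : V ≃ₗᵢ[ℝ] V) q⟫ ^ 2) x := fun s x =>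
      (HasFDerivAt.finsetProd fun k _ => ((hdiff _ _ x).differentiableAt.fun_pow 2).hasFDerivAt).differentiableAt
    have hone : HasFDerivAt h (M q • innerSL ℝ v) q := by
      have := (hdiff v q q).fun_mul (hprod (Finset.univ.erase 1) q).hasFDerivAt
      simpa only [sub_self, inner_zero_right, zero_smul, zero_add] using this
    have hother : ∀ g : G, g ≠ 1 → HasFDerivAt h (0 : V →L[ℝ] ℝ) ((g : V ≃ₗᵢ[ℝ] V)⁻¹ q) := by
      intro g hg
      have hmem : g⁻¹ ∈ Finset.univ.erase (1 : G) := by simpa using hg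
      have hh : h = fun x => ⟪u g⁻¹, x - (g : V ≃ₗᵢ[ℝ] V)⁻¹ q⟫ * ⟪u g⁻¹, x - (g : V ≃ₗᵢ[ℝ] V)⁻¹ q⟫ *
          (⟪v, x - q⟫ *
            ∏ k ∈ (Finset.univ.erase (1 : G)).erase g⁻¹, ⟪u k, x - (k : V ≃ₗᵢ[ℝ] V) q⟫ ^ 2) := by
        funext x
        simp only [h, M, ← Finset.mul_prod_erase _ _ hmem, Subgroup.coe_inv]
        ring
      rw [hh]
      have h1 := hdiff (u g⁻¹) ((g : V ≃ₗᵢ[ℝ] V)⁻¹ q) ((g : V ≃ₗᵢ[ℝ] V)⁻¹ q)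
      have h2 := ((hdiff v q ((g : V ≃ₗᵢ[ℝ] V)⁻¹ q)).differentiableAt.fun_mul
        (hprod ((Finset.univ.erase (1 : G)).erase g⁻¹) ((g : V ≃ₗᵢ[ℝ] V)⁻¹ q))).hasFDerivAt
      have h3 := (h1.fun_mul h1).fun_mul h2
      simpa only [sub_self, inner_zero_right, zero_smul, zero_add, mul_zero, smul_zero] using h3
    have hcomp : ∀ g : G, HasFDerivAt (fun x => h ((g : V ≃ₗᵢ[ℝ] V)⁻¹ x))
        (if g = 1 then M q • innerSL ℝ v else 0) q := by
      intro g
      have h1 := ((g : V ≃ₗᵢ[ℝ] V)⁻¹.toContinuousLinearEquiv.toContinuousLinearMap).hasFDerivAt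
        (x := q)
      split_ifs with hg
      · subst hg
        simpa using hone
      · exact ((hother g hg).comp q h1).congr_fderiv (ContinuousLinearMap.zero_comp _)
    have hsum := HasFDerivAt.fun_sum fun (g : G) (_ : g ∈ Finset.univ) => hcomp g
    rw [funext hF, hsum.fderiv]
    simp only [Finset.sum_ite_eq', Finset.mem_univ, if_true, smul_apply,
      innerSL_apply_apply, smul_eq_mul]
    refine mul_ne_zero (Finset.prod_ne_zero_iff.mpr fun k hk => pow_ne_zero 2 ?_)
      (inner_self_ne_zero.mpr hv)
    refine inner_self_ne_zero.mpr (sub_ne_zero.mpr fun hkq => (Finset.ne_of_mem_erase hk) ?_)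
    exact Subtype.ext (hq k k.2 hkq.symm)

/-- At a point with trivial stabilizer the invariants map onto a neighbourhood. -/
theorem range_value_mem_nhds {G : Subgroup (V ≃ₗᵢ[ℝ] V)} [Finite G]
    {π : Fin n → MvPolynomial (Fin n) ℝ}
    (hπ : Algebra.adjoin ℝ (Set.range π) = invariants b G) {q : V}
    (hq : ∀ g ∈ G, g q = q → g = 1) :
    Set.range (fun p i => value b (π i) p) ∈ 𝓝 fun i => value b (π i) q := by
  have := Module.Finite.of_basis b
  have := FiniteDimensional.complete ℝ V
  have hs : ContDiff ℝ 1 fun p i => value b (π i) p := contDiff_pi.mpr fun i => contDiff_value b (π i)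
  have hd := hs.contDiffAt.hasStrictFDerivAt (x := q) one_ne_zero
  set D := fderiv ℝ (fun p i => value b (π i) p) q
  -- A kernel vector is annihilated by the differentials of the generators, hence of all invariants,
  -- so it is zero. Equal dimensions then give surjectivity.
  have hinj : Function.Injective D.toLinearMap := by
    rw [← LinearMap.ker_eq_bot, LinearMap.ker_eq_bot']
    intro v hv
    by_contra hv0
    obtain ⟨F, hF, hne⟩ := exists_invariant_fderiv_ne_zero b hq hv0
    rw [← hπ] at hF
    refine hne (fderiv_value_eq_zero_of_mem_adjoin b ?_ hF)
    rintro _ ⟨i, rfl⟩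
    have h1 := (hasFDerivAt_pi'.mp hd.hasFDerivAt i).fderiv
    rw [h1]
    exact congrFun hv i
  have hsurj : Function.Surjective D.toLinearMap := by
    refine (LinearMap.injective_iff_surjective_of_finrank_eq_finrank ?_).mp hinj
    rw [Module.finrank_eq_card_basis b, Module.finrank_fin_fun, Fintype.card_fin]
  rw [← hd.map_nhds_eq_of_surj (LinearMap.range_eq_top.mpr hsurj)]
  exact Filter.range_mem_map

end Value

/-! ### Homogeneous components and the squared norm -/

open MvPolynomial in
theorem homogeneousComponent_mul {σ R : Type*} [CommSemiring R] (k : ℕ) (f g : MvPolynomial σ R) :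
    homogeneousComponent k (f * g) =
      ∑ x ∈ Finset.HasAntidiagonal.antidiagonal k, homogeneousComponent x.1 f * homogeneousComponent x.2 g := by
  classical
  ext d
  simp only [coeff_homogeneousComponent, coeff_sum, coeff_mul]
  rw [Finset.sum_comm, ← mul_boole, Finset.sum_mul]
  refine Finset.sum_congr rfl fun y hy => ?_
  have hd : Finsupp.degree d = Finsupp.degree y.1 + Finsupp.degree y.2 := by
    rw [← Finset.HasAntidiagonal.mem_antidiagonal.mp hy, map_add]
  have hterm : ∀ x : ℕ × ℕ, ((if Finsupp.degree y.1 = x.1 then coeff y.1 f else 0) *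
      if Finsupp.degree y.2 = x.2 then coeff y.2 g else 0) =
      if (Finsupp.degree y.1, Finsupp.degree y.2) = x then coeff y.1 f * coeff y.2 g else 0 := by
    rintro ⟨i, j⟩
    simp only [ite_zero_mul_ite_zero, Prod.mk.injEq]
  simp only [hterm, Finset.sum_ite_eq, Finset.HasAntidiagonal.mem_antidiagonal, ← hd, mul_boole]

section NormSq

variable {V : Type*} [NormedAddCommGroup V] [InnerProductSpace ℝ V] {n : ℕ}
  (b : Module.Basis (Fin n) ℝ V)

theorem eq_zero_of_value_eq_zero {f : MvPolynomial (Fin n) ℝ} (h : ∀ p, value b f p = 0) :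
    f = 0 := by
  refine MvPolynomial.funext fun x => ?_
  have hx : (fun i => b.repr (b.equivFun.symm x) i) = x := b.equivFun.apply_symm_apply x
  rw [map_zero, ← h (b.equivFun.symm x), value, hx]

theorem isHomogeneous_innerPoly (w : V) : (innerPoly b w).IsHomogeneous 1 :=
  MvPolynomial.IsHomogeneous.sum _ _ _ fun i _ => by
    simpa using (MvPolynomial.isHomogeneous_C (Fin n) ⟪w, b i⟫).mul (MvPolynomial.isHomogeneous_X ℝ i)

/-- The polynomial `‖p‖ ^ 2`. -/
noncomputable def normSqPoly : MvPolynomial (Fin n) ℝ :=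
  ∑ i, MvPolynomial.X i * innerPoly b (b i)

theorem isHomogeneous_normSqPoly : (normSqPoly b).IsHomogeneous 2 :=
  MvPolynomial.IsHomogeneous.sum _ _ _ fun i _ =>
    (MvPolynomial.isHomogeneous_X ℝ i).mul (isHomogeneous_innerPoly b (b i))

theorem value_normSqPoly (p : V) : value b (normSqPoly b) p = ‖p‖ ^ 2 := by
  have h : ∀ i, value b (MvPolynomial.X i) p = b.repr p i := fun i => by simp [value]
  have hsum : ⟪∑ i, b.repr p i • b i, p⟫ = ‖p‖ ^ 2 := by
    rw [b.sum_repr, real_inner_self_eq_norm_sq]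
  simp only [← hsum, normSqPoly, value_sum, value_mul, value_innerPoly, h, sum_inner,
    real_inner_smul_left]

theorem normSqPoly_mem_invariants (G : Subgroup (V ≃ₗᵢ[ℝ] V)) :
    normSqPoly b ∈ invariants b G := fun g _ p => by
  rw [value_normSqPoly, value_normSqPoly, LinearIsometryEquiv.norm_map]

/-- An essential group has no invariant linear forms. -/
theorem eq_zero_of_isHomogeneous_one {G : Subgroup (V ≃ₗᵢ[ℝ] V)} (hess : IsEssential G)
    {f : MvPolynomial (Fin n) ℝ} (hf : f ∈ invariants b G) (h1 : f.IsHomogeneous 1) : f = 0 := by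
  have := Module.Finite.of_basis b
  have := FiniteDimensional.complete ℝ V
  have hw : ∃ w : V, ∀ p, value b f p = ⟪w, p⟫ := by
    have hspan := (MvPolynomial.mem_homogeneousSubmodule 1 f).mpr h1
    rw [MvPolynomial.homogeneousSubmodule_one_eq_span_X] at hspan
    clear hf h1
    induction hspan using Submodule.span_induction with
    | mem f hf =>
      obtain ⟨i, rfl⟩ := hf
      refine ⟨(InnerProductSpace.toDual ℝ V).symm (b.coord i).toContinuousLinearMap, fun p => ?_⟩
      rw [InnerProductSpace.toDual_symm_apply]
      simp [value]
    | zero => exact ⟨0, fun p => by simp [value]⟩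
    | add f g _ _ hf hg =>
      obtain ⟨w, hw⟩ := hf
      obtain ⟨w', hw'⟩ := hg
      exact ⟨w + w', fun p => by rw [value_add, hw, hw', inner_add_left]⟩
    | smul c f _ hf =>
      obtain ⟨w, hw⟩ := hf
      exact ⟨c • w, fun p => by rw [value_smul, hw, real_inner_smul_left]⟩
  obtain ⟨w, hw⟩ := hw
  -- Invariance of the form makes its Riesz vector `w` fixed by `G`; essentiality then kills the
  -- span of `w`.
  have hfix : ∀ g ∈ G, g w = w := by
    intro g hg
    refine ext_inner_right ℝ fun p => ?_
    have hx : g (g⁻¹ p) = p := g.apply_symm_apply p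
    rw [← hw p, ← hf g hg p, hw]
    conv_lhs => rw [← hx, g.inner_map_map]
  have hU := hess (Submodule.span ℝ {w}) fun g hg p hp => by
    obtain ⟨c, rfl⟩ := Submodule.mem_span_singleton.mp hp
    rw [map_smul, hfix g hg]
  rw [Submodule.span_singleton_eq_bot] at hU
  exact eq_zero_of_value_eq_zero b fun p => by rw [hw, hU, inner_zero_left]

/-- The squared norm is a linear combination of homogeneous generators of the invariants. -/
theorem exists_norm_sq_eq_sum {G : Subgroup (V ≃ₗᵢ[ℝ] V)} (hess : IsEssential G)
    {π : Fin n → MvPolynomial (Fin n) ℝ} (hh : ∀ i, ∃ d : ℕ, (π i).IsHomogeneous d)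
    (hπ : Algebra.adjoin ℝ (Set.range π) = invariants b G) :
    ∃ c : Fin n → ℝ, ∀ p, ‖p‖ ^ 2 = ∑ i, c i * value b (π i) p := by
  -- The vanishing of degree 1 is carried along for products: it reduces the degree-2 part of `f *
  -- g` to `f₀ g₂ + f₂ g₀`, which stays in the span.
  have key : ∀ f ∈ Algebra.adjoin ℝ (Set.range π), MvPolynomial.homogeneousComponent 1 f = 0 ∧
      MvPolynomial.homogeneousComponent 2 f ∈ Submodule.span ℝ (Set.range π) := by
    intro f hf
    have hC : ∀ (k : ℕ) (r : ℝ), MvPolynomial.homogeneousComponent (k + 1)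
        (algebraMap ℝ (MvPolynomial (Fin n) ℝ) r) = 0 := fun k r =>
      MvPolynomial.homogeneousComponent_eq_zero _ _ (by simp)
    induction hf using Algebra.adjoin_induction with
    | mem f hf =>
      obtain ⟨i, rfl⟩ := hf
      obtain ⟨d, hd⟩ := hh i
      rw [MvPolynomial.homogeneousComponent_of_mem hd, MvPolynomial.homogeneousComponent_of_mem hd]
      constructor
      · split_ifs with h
        · subst h
          refine eq_zero_of_isHomogeneous_one b hess ?_ hd
          exact hπ ▸ Algebra.subset_adjoin ⟨i, rfl⟩
        · rfl
      · split_ifs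
        exacts [Submodule.subset_span ⟨i, rfl⟩, Submodule.zero_mem _]
    | algebraMap r => exact ⟨hC 0 r, by rw [hC 1 r]; exact Submodule.zero_mem _⟩
    | add f g _ _ hf hg =>
      rw [map_add, map_add, hf.1, hg.1, add_zero]
      exact ⟨rfl, Submodule.add_mem _ hf.2 hg.2⟩
    | mul f g _ _ hf hg =>
      rw [homogeneousComponent_mul, homogeneousComponent_mul]
      simp only [Finset.Nat.antidiagonal_succ, Finset.Nat.antidiagonal_zero, Finset.map_singleton,
        Finset.sum_cons, Finset.map_cons, Finset.sum_singleton, Function.Embedding.prodMap,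
        Function.Embedding.coeFn_mk, Prod.map, Function.Embedding.refl_apply, Nat.succ_eq_add_one,
        zero_add, Nat.reduceAdd, hf.1, hg.1, MvPolynomial.homogeneousComponent_zero, mul_zero,
        zero_mul, add_zero, true_and]
      rw [← MvPolynomial.smul_eq_C_mul, mul_comm, ← MvPolynomial.smul_eq_C_mul]
      exact Submodule.add_mem _ (Submodule.smul_mem _ _ hg.2) (Submodule.smul_mem _ _ hf.2)
  have h2 := (key _ (hπ ▸ normSqPoly_mem_invariants b G)).2
  rw [MvPolynomial.homogeneousComponent_eq_self (isHomogeneous_normSqPoly b)] at h2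
  obtain ⟨c, hc⟩ := (Submodule.mem_span_range_iff_exists_fun ℝ).mp h2
  refine ⟨c, fun p => ?_⟩
  rw [← value_normSqPoly b, ← hc, value_sum]
  simp only [value_smul]

end NormSq

/-! ### Extremal points of the fibers -/

section Fibers

variable {V : Type*} [NormedAddCommGroup V] [InnerProductSpace ℝ V] {n : ℕ}
  (b : Module.Basis (Fin n) ℝ V)

theorem mem_stratum_of_not_isRegular {G : Subgroup (V ≃ₗᵢ[ℝ] V)} {q : V}
    (hn : Module.finrank ℝ V = n) [FiniteDimensional ℝ V] (hq : ¬ IsRegular G q) :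
    q ∈ stratum G (n - 1) := by
  simp only [IsRegular, not_forall, not_not] at hq
  obtain ⟨g, hg, ⟨v, hv, rfl⟩, hgq⟩ := hq
  refine ⟨(Submodule.span ℝ {v})ᗮ, ⟨{(Submodule.span ℝ {v})ᗮ}, ?_, sInf_singleton.symm⟩, ?_,
    Submodule.reflection_eq_self_iff q |>.mp hgq⟩
  · rintro _ rfl
    exact ⟨_, hg, ⟨v, hv, rfl⟩, fun p => (Submodule.reflection_eq_self_iff p).symm⟩
  · have := (Submodule.span ℝ {v}).finrank_add_finrank_orthogonal
    rw [finrank_span_singleton hv] at this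
    omega

/-- At a point off the hyperplanes one invariant can be moved in both directions while the others
are kept. -/
theorem exists_value_update {G : Subgroup (V ≃ₗᵢ[ℝ] V)} (hG : IsReflectionGroup G)
    {π : Fin n → MvPolynomial (Fin n) ℝ}
    (hπ : Algebra.adjoin ℝ (Set.range π) = invariants b G) {q : V} (hq : IsRegular G q)
    (k : Fin n) (s : ℝ) :
    ∃ ε > 0, ∃ x, ∀ i, value b (π i) x = value b (π i) q + if i = k then ε * s else 0 := by
  have := hG.finite
  have hmem := range_value_mem_nhds b hπ fun g hg h => hq.eq_one_of_apply_eq hG hg h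
  have ht : Filter.Tendsto (fun ε : ℝ => fun i => value b (π i) q + if i = k then ε * s else 0)
      -- `ε` tends to `0` from the right, so the sign of `s` alone decides the direction of the
      -- move.
      (𝓝[>] 0) (𝓝 fun i => value b (π i) q) := by
    refine tendsto_nhdsWithin_of_tendsto_nhds (tendsto_pi_nhds.mpr fun i => ?_)
    have : Continuous fun ε : ℝ => value b (π i) q + if i = k then ε * s else 0 := by
      split_ifs <;> fun_prop
    simpa using this.tendsto 0
  obtain ⟨ε, ⟨x, hx⟩, hε⟩ := ((ht.eventually hmem).and self_mem_nhdsWithin).exists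
  exact ⟨ε, hε, x, congrFun hx⟩

/-- Each fiber of all but one basic invariant meets a reflection hyperplane. -/
theorem exists_mem_stratum_value_eq {G : Subgroup (V ≃ₗᵢ[ℝ] V)} (hG : IsReflectionGroup G)
    (hess : IsEssential G) {π : Fin n → MvPolynomial (Fin n) ℝ} (hπ : IsBasicInvariants b G π)
    (k : Fin n) (p : V) :
    ∃ q ∈ stratum G (n - 1), ∀ i, i ≠ k → value b (π i) q = value b (π i) p := by
  have := Module.Finite.of_basis b
  have := FiniteDimensional.proper ℝ V
  have hn : Module.finrank ℝ V = n := by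
    rw [Module.finrank_eq_card_basis b, Fintype.card_fin]
  obtain ⟨c, hc⟩ := exists_norm_sq_eq_sum b hess hπ.homogeneous hπ.generate
  set S : Set V := {q | ∀ i, i ≠ k → value b (π i) q = value b (π i) p}
  have hp : p ∈ S := fun _ _ => rfl
  have hS : IsClosed S := by
    simp only [S, Set.ofPred_forall]
    exact isClosed_iInter fun i => isClosed_iInter fun _ =>
      isClosed_eq (continuous_value b (π i)) continuous_const
  have hsum : ∀ x, ‖x‖ ^ 2 = c k * value b (π k) x +
      ∑ i ∈ Finset.univ.erase k, c i * value b (π i) x := fun x => by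
    rw [hc, Finset.add_sum_erase _ (fun i => c i * value b (π i) x) (Finset.mem_univ k)]
  have hrest : ∀ x ∈ S, ∑ i ∈ Finset.univ.erase k, c i * value b (π i) x =
      ∑ i ∈ Finset.univ.erase k, c i * value b (π i) p := fun x hx =>
    Finset.sum_congr rfl fun i hi => by rw [hx i (Finset.ne_of_mem_erase hi)]
  have hmove : ∀ q ∈ S, IsRegular G q → ∀ s : ℝ, ∃ ε > 0, ∃ x ∈ S,
      value b (π k) x = value b (π k) q + ε * s := by
    intro q hq hreg s
    obtain ⟨ε, hε, x, hx⟩ := exists_value_update b hG hπ.generate hreg k s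
    refine ⟨ε, hε, x, fun i hi => ?_, by simpa using hx k⟩
    rw [hx i, if_neg hi, add_zero, hq i hi]
  by_cases hk : c k = 0
  · have hbdd : Bornology.IsBounded S := by
      refine (Metric.isBounded_closedBall (x := (0 : V)) (r := ‖p‖)).subset fun x hx => ?_
      rw [mem_closedBall_zero_iff]
      refine (sq_le_sq₀ (norm_nonneg x) (norm_nonneg p)).mp (le_of_eq ?_)
      rw [hsum x, hsum p, hk, zero_mul, zero_mul, hrest x hx]
    obtain ⟨q, hq, hmax⟩ := (Metric.isCompact_of_isClosed_isBounded hS hbdd).exists_isMaxOn ⟨p, hp⟩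
      (continuous_value b (π k)).continuousOn
    refine ⟨q, mem_stratum_of_not_isRegular hn fun hreg => ?_, hq⟩
    obtain ⟨ε, hε, x, hx, hxk⟩ := hmove q hq hreg 1
    have := hmax hx
    simp only [Set.mem_ofPred_eq] at this
    linarith
  · obtain ⟨q, hq, hmin⟩ := hS.exists_infDist_eq_dist ⟨p, hp⟩ 0
    refine ⟨q, mem_stratum_of_not_isRegular hn fun hreg => ?_, hq⟩
    -- This choice of `s` lowers the squared norm by `ε * (c k) ^ 2`, whatever the sign of `c k`.
    obtain ⟨ε, hε, x, hx, hxk⟩ := hmove q hq hreg (-c k)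
    have h1 := Metric.infDist_le_dist_of_mem (x := (0 : V)) hx
    rw [hmin, dist_zero_left, dist_zero_left] at h1
    have h2 : ‖q‖ ^ 2 ≤ ‖x‖ ^ 2 := pow_le_pow_left₀ (norm_nonneg q) h1 2
    rw [hsum x, hsum q, hrest x hx, hrest q hq, hxk] at h2
    have h3 : 0 < ε * (c k) ^ 2 := mul_pos hε (by positivity)
    linarith

end Fibers

end ReflGroup

theorem corollary3p5 {V : Type*} [NormedAddCommGroup V] [InnerProductSpace ℝ V] {n : ℕ}
    (b : Module.Basis (Fin n) ℝ V) (G : Subgroup (V ≃ₗᵢ[ℝ] V))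
    (hG : ReflGroup.IsReflectionGroup G) (hess : ReflGroup.IsEssential G)
    (π : Fin n → MvPolynomial (Fin n) ℝ) (hπ : ReflGroup.IsBasicInvariants b G π)
    (J : Finset (Fin n)) (hJ : J.card + 1 = n)
    {m : ℕ} (f : MvPolynomial (Fin n) ℝ) (fs : Fin m → MvPolynomial (Fin n) ℝ)
    (hf : f ∈ Algebra.adjoin ℝ (π '' (J : Set (Fin n))))
    (hfs : ∀ i, fs i ∈ Algebra.adjoin ℝ (π '' (J : Set (Fin n)))) :
    ((ReflGroup.semialgebraicSet b fs).Nonempty ↔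
      (ReflGroup.semialgebraicSet b fs ∩ ReflGroup.stratum G (n - 1)).Nonempty) ∧
    ((∀ q ∈ ReflGroup.semialgebraicSet b fs, 0 ≤ ReflGroup.value b f q) ↔
      ∀ q ∈ ReflGroup.semialgebraicSet b fs ∩ ReflGroup.stratum G (n - 1),
        0 ≤ ReflGroup.value b f q) := by
  obtain ⟨k, hk⟩ : ∃ k, k ∉ J := by
    by_contra! h
    rw [Finset.eq_univ_of_forall h, Finset.card_fin] at hJ
    omega
  have key : ∀ p : V, ∃ q ∈ ReflGroup.stratum G (n - 1),
      ∀ h ∈ Algebra.adjoin ℝ (π '' (J : Set (Fin n))),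
        ReflGroup.value b h q = ReflGroup.value b h p := by
    intro p
    obtain ⟨q, hq, hqp⟩ := ReflGroup.exists_mem_stratum_value_eq b hG hess hπ k p
    refine ⟨q, hq, fun h hh => ReflGroup.value_eq_of_mem_adjoin b ?_ hh⟩
    rintro _ ⟨i, hi, rfl⟩
    exact hqp i fun hik => hk (hik ▸ hi)
  refine ⟨⟨fun ⟨p, hp⟩ => ?_, fun h => h.left⟩, fun h q hq => h q hq.1, fun h p hp => ?_⟩
  · obtain ⟨q, hq, hqp⟩ := key p
    exact ⟨q, fun i => by rw [hqp _ (hfs i)]; exact hp i, hq⟩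
  · obtain ⟨q, hq, hqp⟩ := key p
    rw [← hqp f hf]
    exact h q ⟨fun i => by rw [hqp _ (hfs i)]; exact hp i, hq⟩
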